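/- Let $I=[t,T]$ with $t<T$, $p\ge 1$ real, $n\ge1$, and let $\Lambda:I\times\mathbb R^n\times\mathbb R^n\to[0,+\infty]$ and $\Psi:I\times\mathbb R^n\to[0,+\infty]$ be Borel functions such that the effective domain $\mathrm{Dom}(\Lambda)=\{(s,z,v):\Lambda(s,z,v)<+\infty\}$ has the form $I\times D_\Lambda$ with $D_\Lambda\subseteq\mathbb R^n\times\mathbb R^n$. Let $B_r$ be the closed ball of radius $r$ centered at the origin of $\mathbb R^n$. For $y\in W^{1,p}(I;\mathbb R^n)$ (identified with its absolutely continuous representative) put $$F(y)=\int_I\Lambda(s,y(s),y'(s))\,\Psi(s,y(s))\,ds\in[0,+\infty].$$ Assume Condition (S): for every $K\ge 0$ there are $\kappa,\beta\ge0$, $\gamma\in L^1(I)$ and $\varepsilon_*>0$ such that, for a.e. $s\in I$, $$|\Lambda(s_2,z,v)-\Lambda(s_1,z,v)|\le\big(\kappa\Lambda(s,z,v)+\beta|v|^p+\gamma(s)\big)|s_2-s_1|$$ whenever $s_1,s_2\in[s-\varepsilon_*,s+\varepsilon_*]\cap I$, $z\in B_K$, $v\in\mathbb R^n$ and $(s,z,v)\in\mathrm{Dom}(\Lambda)$.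 Let $y\in W^{1,p}(I;\mathbb R^n)$ be such that $F(y)<+\infty$ and $\Lambda(\cdot,y,y')\in L^1(I)$. Suppose that there is a neighbourhood $\mathcal O_y$ of $y(I)$ in $\mathbb R^n$ such that $\Psi$ is bounded on $I\times\mathcal O_y$; that $s\mapsto\Psi(s,z)$ is continuous on $I$ for every $z\in y(I)$; and that $\Lambda$ is bounded on $I\times\mathcal O_y\times B_{\nu_0}$ for some $\nu_0>0$. Then: (1) There is no Lavrentiev gap at $y$ for the problem with the initial end-point condition: there is a sequence $(y_h)_{h\in\mathbb N}$ of Lipschitz functions $I\to\mathbb R^n$ with $y_h(t)=y(t)$ for all $h$, $y_h\to y$ in $W^{1,p}(I;\mathbb R^n)$ and $F(y_h)\to F(y)$. (2) If, moreover, there is a nonempty relatively open subset $U_y$ of $y(I)$ such that $\Lambda$ is bounded on $I\times U_y\times B_r$ for every $r>0$, then there is no Lavrentiev gap at $y$ for the problem with both end-point conditions: there is a sequence $(y_h)_{h\in\mathbb N}$ of Lipschitz functions $I\to\mathbb R^n$ with $y_h(t)=y(t)$ and $y_h(T)=y(T)$ for all $h$, $y_h\to y$ in $W^{1,p}(I;\mathbb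 R^n)$ and $F(y_h)\to F(y)$. -/

import Mathlib

open MeasureTheory Set Filter Topology
open scoped NNReal ENNReal

noncomputable section

namespace Lavrentiev

variable {n : ℕ}

/-- The space of values of the trajectories, with its Euclidean norm. -/
abbrev E (n : ℕ) : Type := EuclideanSpace ℝ (Fin n)

/-- Lebesgue measure on the interval `I = [t, T]`. -/
abbrev volI (t T : ℝ) : Measure ℝ := volume.restrict (Icc t T)

/-- `y ∈ W^{1,p}([t,T]; ℝⁿ)`, for the (absolutely) continuous representative, which is the one
that end-point conditions refer to. Only the values of `y` on `[t, T]` matter; for an absolutely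
continuous `y`, `deriv y` is the derivative `y'` at almost every point of `[t, T]`. -/
structure IsW1p (p t T : ℝ) (y : ℝ → E n) : Prop where
  absCont : AbsolutelyContinuousOnInterval y t T
  memLp : MemLp y (ENNReal.ofReal p) (volI t T)
  memLp_deriv : MemLp (deriv y) (ENNReal.ofReal p) (volI t T)

/-- `y` is Lipschitz on `[t, T]`. -/
def IsLip (t T : ℝ) (y : ℝ → E n) : Prop :=
  ∃ C : ℝ≥0, LipschitzOnWith C y (Icc t T)

/-- The distance of `W^{1,p}([t,T]; ℝⁿ)`: `‖x - y‖_p + ‖x' - y'‖_p`. -/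
def distW1p (p t T : ℝ) (x y : ℝ → E n) : ℝ≥0∞ :=
  eLpNorm (fun s => x s - y s) (ENNReal.ofReal p) (volI t T) +
    eLpNorm (fun s => deriv x s - deriv y s) (ENNReal.ofReal p) (volI t T)

/-- The functional `F(y) = ∫_t^T Λ(s, y(s), y'(s)) Ψ(s, y(s)) ds`, with values in `[0, ∞]`. -/
def energy (t T : ℝ) (Λ : ℝ → E n → E n → ℝ≥0∞) (Ψ : ℝ → E n → ℝ≥0∞) (y : ℝ → E n) : ℝ≥0∞ :=
  ∫⁻ s in Icc t T, Λ s (y s) (deriv y s) * Ψ s (y s)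

/-- The effective domain of `Λ`, i.e. the set of points of `I × ℝⁿ × ℝⁿ` where it is finite. -/
def effDom (t T : ℝ) (Λ : ℝ → E n → E n → ℝ≥0∞) : Set (ℝ × E n × E n) :=
  {q | q.1 ∈ Icc t T ∧ Λ q.1 q.2.1 q.2.2 < ∞}

/-- The basic assumptions: `Λ` and `Ψ` are Borel on `I × ℝⁿ × ℝⁿ` and on `I × ℝⁿ`, and the
effective domain of `Λ` is a product `I × D`. -/
structure BasicAssumptions (t T : ℝ) (Λ : ℝ → E n → E n → ℝ≥0∞) (Ψ : ℝ → E n → ℝ≥0∞) :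
    Prop where
  measurable_Λ : Measurable (fun q : Icc t T × E n × E n => Λ q.1 q.2.1 q.2.2)
  measurable_Ψ : Measurable (fun q : Icc t T × E n => Ψ q.1 q.2)
  effDom_eq : ∃ D : Set (E n × E n), effDom t T Λ = Icc t T ×ˢ D

/-- Condition (S), the local Lipschitz condition of `Λ` in the time variable. It is used for `Λ`
whose effective domain is a product `I × D`, and then the values of `Λ` below are all finite. -/
def ConditionS (p t T : ℝ) (Λ : ℝ → E n → E n → ℝ≥0∞) : Prop :=
  ∀ K : ℝ, 0 ≤ K → ∃ (κ β : ℝ) (γ : ℝ → ℝ) (ε : ℝ),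
    0 ≤ κ ∧ 0 ≤ β ∧ IntegrableOn γ (Icc t T) ∧ 0 < ε ∧
    ∀ᵐ s ∂(volI t T), ∀ s₁ ∈ Icc (s - ε) (s + ε) ∩ Icc t T,
      ∀ s₂ ∈ Icc (s - ε) (s + ε) ∩ Icc t T, ∀ z v : E n, ‖z‖ ≤ K → (s, z, v) ∈ effDom t T Λ →
        |(Λ s₂ z v).toReal - (Λ s₁ z v).toReal| ≤
          (κ * (Λ s z v).toReal + β * ‖v‖ ^ p + γ s) * |s₂ - s₁|

/-- The trajectories in `W^{1,p}` with the initial end-point condition `y(t) = X`. -/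
def admissibleInit (p t T : ℝ) (X : E n) : Set (ℝ → E n) :=
  {y | IsW1p p t T y ∧ y t = X}

/-- The trajectories in `W^{1,p}` with both end-point conditions `y(t) = X`, `y(T) = Y`. -/
def admissibleBoth (p t T : ℝ) (X Y : E n) : Set (ℝ → E n) :=
  {y | IsW1p p t T y ∧ y t = X ∧ y T = Y}

/-- The Lavrentiev gap does not occur at `y` for the problem of minimizing the energy over `Γ`:
some Lipschitz functions `y_h` in `Γ` converge to `y` in `W^{1,p}` and in energy. -/
def NoLavrentievGap (p t T : ℝ) (Λ : ℝ → E n → E n → ℝ≥0∞) (Ψ : ℝ → E n → ℝ≥0∞)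
    (Γ : Set (ℝ → E n)) (y : ℝ → E n) : Prop :=
  ∃ yh : ℕ → ℝ → E n,
    (∀ h, IsLip t T (yh h) ∧ yh h ∈ Γ) ∧
    Tendsto (fun h => energy t T Λ Ψ (yh h)) atTop (𝓝 (energy t T Λ Ψ y)) ∧
    Tendsto (fun h => distW1p p t T (yh h) y) atTop (𝓝 0)

end Lavrentiev

end

/-! ### Time changes of the line -/

noncomputable section

namespace Lavrentiev

variable {n : ℕ}

/-! The approximations are reparametrizations `y ∘ φ⁻¹` of the same curve, where `φ` is the
primitive of a positive weight `w`. On the set `A` where `|y'| > r + h` the weight is `|y'| / ν`, so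
that the new speed there is exactly `ν`; elsewhere it is `1`. The new curve is then Lipschitz, takes
its values in `y(I)`, and agrees with `y` at `t`. Stretching only lengthens time, so `φ T ≥ T` and
the new curve stops at `φ⁻¹ T ≤ T`: this settles the initial condition.

To reach `y(T)` at time `T`, the excess time is recovered on a set `S` of points where `|y'| ≤ c`
and `y` lies in the open set of the second hypothesis: there `w = 1/2`, the speed doubles, and `|S|`
equal to twice the excess gives `φ T = T`.

Let `Z = A ∪ S`. Since `y'` is integrable, the mass of `w` on `Z` tends to `0` as `h → ∞`, and it
controls `|φ x - x|`. Substituting `s = φ x`, the energy becomes the integral of `w Λ(φ x, y, y'/w)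
Ψ(φ x, y)`. On `Z` the new velocities are bounded, hence so are `Λ` and `Ψ`, and the contribution
vanishes. Off `Z` only the time variable has moved: Condition (S) and the continuity of `Ψ` in time
give the limit by dominated convergence (`tendsto_lintegral_projIcc`, `tendsto_energy`). Convergence
of the derivatives in `L^p` uses the same splitting (`tendsto_eLpNorm_deriv`). -/

/-- `φ` is the primitive of `w ≥ 1/2` that fixes `t`, as a homeomorphism of the line. -/
structure TimeChange (t : ℝ) (w : ℝ → ℝ) (φ : ℝ ≃ₜ ℝ) : Prop where
  measurable : Measurable w
  half_le : ∀ x, 1 / 2 ≤ w x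
  intervalIntegrable : ∀ a b, IntervalIntegrable w volume a b
  strictMono : StrictMono φ
  map_init : φ t = t
  sub_eq : ∀ a b, φ b - φ a = ∫ x in a..b, w x
  ae_hasDerivAt : ∀ᵐ x, HasDerivAt φ (w x) x
  map_symm : Measure.map φ.symm volume = volume.withDensity (fun x => ENNReal.ofReal (w x))

theorem exists_timeChange (t : ℝ) {w : ℝ → ℝ} (hw : Measurable w) (hpos : ∀ x, 1 / 2 ≤ w x)
    (hint : LocallyIntegrable w) : ∃ φ : ℝ ≃ₜ ℝ, TimeChange t w φ := by
  have hii : ∀ a b, IntervalIntegrable w volume a b := fun a b =>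
    intervalIntegrable_iff.mpr
      ((hint.integrableOn_isCompact isCompact_uIcc).mono_set uIoc_subset_uIcc)
  set f : ℝ → ℝ := fun x => t + ∫ u in t..x, w u with hf
  have hsub : ∀ a b, f b - f a = ∫ x in a..b, w x := by
    intro a b
    simp only [hf, add_sub_add_left_eq_sub]
    exact intervalIntegral.integral_interval_sub_left (hii _ _) (hii _ _)
  have hge : ∀ a b, a ≤ b → (b - a) / 2 ≤ f b - f a := by
    intro a b hab
    rw [hsub]
    calc (b - a) / 2 = ∫ x in a..b, (1 / 2 : ℝ) := by simp; ring
      _ ≤ _ := intervalIntegral.integral_mono_on hab (by simp) (hii _ _) (fun x _ => hpos x)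
  have hcont : Continuous f :=
    continuous_const.add (intervalIntegral.continuous_primitive hii t)
  have hmono : StrictMono f := by
    intro a b hab
    have := hge a b hab.le
    linarith
  have hft : f t = t := by simp [hf]
  have hsurj : Function.Surjective f := by
    refine hcont.surjective ?_ ?_
    · refine tendsto_atTop_mono' atTop
        (f₁ := fun x => t + (x - t) / 2) ?_ ?_
      · filter_upwards [eventually_ge_atTop t] with x hx
        have := hge t x hx
        linarith
      · exact tendsto_atTop_add_const_left _ _
          ((tendsto_atTop_add_const_right _ _ tendsto_id).atTop_div_const (by norm_num))
    · refine tendsto_atBot_mono' atBot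
        (f₁ := fun x => t + (x - t) / 2) ?_ ?_
      · filter_upwards [eventually_le_atBot t] with x hx
        have := hge x t hx
        linarith
      · exact tendsto_atBot_add_const_left _ _
          ((tendsto_atBot_add_const_right _ _ tendsto_id).atBot_div_const (by norm_num))
  let e := (hmono.orderIsoOfSurjective f hsurj)
  have hef : ∀ x, e x = f x := fun x => rfl
  refine ⟨e.toHomeomorph, hw, hpos, hii, hmono, hft, hsub, ?_, ?_⟩
  · filter_upwards [_root_.LocallyIntegrable.ae_hasDerivAt_integral hint] with x hx
    exact (hx t).const_add t
  -- Both measures give `(p, q)` the mass `f q - f p` (zero if `q < p`), and intervals with rational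
  -- ends determine a locally finite measure.
  · have hIoo : ∀ p q : ℝ, Measure.map e.toHomeomorph.symm volume (Ioo p q) =
        ENNReal.ofReal (f q - f p) := by
      intro p q
      rw [Measure.map_apply e.toHomeomorph.symm.continuous.measurable measurableSet_Ioo,
        ← Real.volume_Ioo]
      congr 1
      ext s
      obtain ⟨x, rfl⟩ := hsurj s
      simp [hef, hmono.lt_iff_lt]
    have : IsLocallyFiniteMeasure (Measure.map e.toHomeomorph.symm volume) :=
      ⟨fun x => ⟨Ioo (x - 1) (x + 1), Ioo_mem_nhds (by linarith) (by linarith), by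
        rw [hIoo]; exact ENNReal.ofReal_lt_top⟩⟩
    refine Real.measure_ext_Ioo_rat fun p q => ?_
    rw [hIoo, withDensity_apply _ measurableSet_Ioo, hsub]
    rcases le_or_gt (p : ℝ) q with h | h
    · rw [intervalIntegral.integral_of_le h, integral_Ioc_eq_integral_Ioo,
        ofReal_integral_eq_lintegral_ofReal]
      · exact ((hii p q).1).mono_set Ioo_subset_Ioc_self
      · exact ae_of_all _ fun x => by have := hpos x; simp; linarith
    · rw [Ioo_eq_empty h.not_gt, ← hsub]
      simpa using (hmono h).le

/-! ### Absolutely continuous curves in Euclidean space -/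

theorem _root_.AbsolutelyContinuousOnInterval.inner_left {y : ℝ → E n} {a b : ℝ}
    (hy : AbsolutelyContinuousOnInterval y a b) (u : E n) :
    AbsolutelyContinuousOnInterval (fun s => inner ℝ u (y s)) a b := by
  rw [absolutelyContinuousOnInterval_iff] at hy ⊢
  intro ε hε
  obtain ⟨δ, hδ, H⟩ := hy (ε / (‖u‖ + 1)) (by positivity)
  refine ⟨δ, hδ, fun E hE hlt => ?_⟩
  have h1 := H E hE hlt
  rw [lt_div_iff₀ (by positivity)] at h1
  refine lt_of_le_of_lt ?_ h1
  rw [Finset.sum_mul]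
  refine Finset.sum_le_sum fun i _ => ?_
  rw [dist_eq_norm, dist_eq_norm, ← inner_sub_right]
  refine (norm_inner_le_norm u _).trans ?_
  rw [mul_comm]
  gcongr
  linarith

theorem _root_.AbsolutelyContinuousOnInterval.ae_differentiableAt_euclidean {y : ℝ → E n} {a b : ℝ}
    (hy : AbsolutelyContinuousOnInterval y a b) (hab : a ≤ b) :
    ∀ᵐ x ∂(volI a b), DifferentiableAt ℝ y x := by
  have h := hy.boundedVariationOn.locallyBoundedVariationOn.ae_differentiableWithinAt_of_mem
  rw [uIcc_of_le hab] at h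
  have hne : ∀ c : ℝ, ∀ᵐ x : ℝ, x ≠ c := fun c => by simp [ae_iff, measure_singleton]
  rw [ae_restrict_iff' measurableSet_Icc]
  filter_upwards [h, hne a, hne b] with x hx h1 h2 hm
  exact (hx hm).differentiableAt
    (Icc_mem_nhds (lt_of_le_of_ne hm.1 (Ne.symm h1)) (lt_of_le_of_ne hm.2 h2))

/-- Projecting the curve on the direction `u = y b - y a` reduces the claim to the scalar
fundamental theorem of calculus, and Cauchy-Schwarz bounds the projected derivative by `‖u‖ * g`. -/
theorem _root_.AbsolutelyContinuousOnInterval.norm_sub_le_integral {y : ℝ → E n} {a b : ℝ}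
    (hy : AbsolutelyContinuousOnInterval y a b) (hab : a ≤ b) {g : ℝ → ℝ}
    (hg : IntervalIntegrable g volume a b) (hle : ∀ x ∈ Icc a b, ‖deriv y x‖ ≤ g x) :
    ‖y b - y a‖ ≤ ∫ x in a..b, g x := by
  set u := y b - y a with hu
  rcases eq_or_ne u 0 with h0 | h0
  · rw [h0, norm_zero]
    exact intervalIntegral.integral_nonneg hab fun x hx => (norm_nonneg _).trans (hle x hx)
  have hac := hy.inner_left u
  have h1 := hac.integral_deriv_eq_sub
  have h2 : ∫ x in a..b, deriv (fun s => inner ℝ u (y s)) x ≤ ∫ x in a..b, ‖u‖ * g x := by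
    refine intervalIntegral.integral_mono_ae_restrict hab hac.intervalIntegrable_deriv
      (hg.const_mul _) ?_
    filter_upwards [hy.ae_differentiableAt_euclidean hab, ae_restrict_mem measurableSet_Icc]
      with x hx hm
    have : deriv (fun s => inner ℝ u (y s)) x = inner ℝ u (deriv y x) :=
      ((hasDerivAt_const x u).inner ℝ hx.hasDerivAt).deriv.trans (by simp)
    rw [this]
    exact (real_inner_le_norm _ _).trans (by gcongr; exact hle x hm)
  rw [h1, ← inner_sub_right, ← hu, real_inner_self_eq_norm_mul_norm,
    intervalIntegral.integral_const_mul] at h2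
  exact le_of_mul_le_mul_left h2 (norm_pos_iff.mpr h0)

/-! ### Reparametrization by a single time change -/

namespace TimeChange

variable {t T : ℝ} {w : ℝ → ℝ} {φ : ℝ ≃ₜ ℝ}

theorem pos (h : TimeChange t w φ) (x : ℝ) : 0 < w x := by
  have := h.half_le x
  linarith

theorem symm_strictMono (h : TimeChange t w φ) : StrictMono φ.symm := by
  intro a b hab
  rw [← h.strictMono.lt_iff_lt]
  simpa using hab

theorem symm_init (h : TimeChange t w φ) : φ.symm t = t := by
  rw [Homeomorph.symm_apply_eq, h.map_init]

theorem symm_le (h : TimeChange t w φ) (hT : T ≤ φ T) : φ.symm T ≤ T := by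
  rw [← h.strictMono.le_iff_le]
  simpa using hT

theorem le_symm (h : TimeChange t w φ) (htT : t ≤ T) : t ≤ φ.symm T := by
  simpa [h.symm_init] using h.symm_strictMono.monotone htT

theorem symm_mem (h : TimeChange t w φ) (hT : T ≤ φ T) {s : ℝ} (hs : s ∈ Icc t T) :
    φ.symm s ∈ Icc t T :=
  ⟨h.le_symm hs.1, (h.symm_strictMono.monotone hs.2).trans (h.symm_le hT)⟩

theorem apply_mem (h : TimeChange t w φ) {x : ℝ} (hx : x ∈ Icc t (φ.symm T)) :
    φ x ∈ Icc t T := by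
  constructor
  · simpa [h.map_init] using h.strictMono.monotone hx.1
  · simpa using h.strictMono.monotone hx.2

theorem map_volI (h : TimeChange t w φ) :
    Measure.map φ.symm (volI t T) =
      (volume.withDensity (fun x => ENNReal.ofReal (w x))).restrict (Icc t (φ.symm T)) := by
  have hpre : φ.symm ⁻¹' Icc t (φ.symm T) = Icc t T := by
    ext s
    rw [mem_preimage, mem_Icc, mem_Icc, h.symm_strictMono.le_iff_le]
    nth_rewrite 1 [← h.symm_init]
    rw [h.symm_strictMono.le_iff_le]
  rw [← h.map_symm, φ.symm.measurableEmbedding.restrict_map, hpre]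

theorem setLIntegral_comp_symm (h : TimeChange t w φ) (G : ℝ → ℝ≥0∞) :
    ∫⁻ s in Icc t T, G (φ.symm s) =
      ∫⁻ x in Icc t (φ.symm T), ENNReal.ofReal (w x) * G x := by
  rw [← φ.symm.measurableEmbedding.lintegral_map, h.map_volI,
    restrict_withDensity measurableSet_Icc,
    lintegral_withDensity_eq_lintegral_mul_non_measurable _ h.measurable.ennreal_ofReal
      (ae_of_all _ fun _ => ENNReal.ofReal_lt_top)]
  rfl

/-- The image of Lebesgue measure under `φ⁻¹` has density `w`, so preimages of null sets under `φ⁻¹`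
are null. -/
theorem ae_comp_symm (h : TimeChange t w φ) {P : ℝ → Prop} (hP : ∀ᵐ x, P x) :
    ∀ᵐ s, P (φ.symm s) := by
  refine ae_of_ae_map φ.symm.continuous.aemeasurable ?_
  rw [h.map_symm]
  exact (withDensity_absolutelyContinuous _ _).ae_le hP

/-- The displacement is the integral of `w - 1`, which vanishes off `Z`; on `Z`, `w ≥ 1/2` gives `|w
- 1| ≤ w`. -/
theorem abs_sub_le (h : TimeChange t w φ) {Z : Set ℝ} (hZ : MeasurableSet Z)
    (hwZ : ∀ x, x ∉ Z → w x = 1) (hint : IntegrableOn w Z) (x : ℝ) :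
    |φ x - x| ≤ ∫ u in Z, w u := by
  have h1 : φ x - x = ∫ u in t..x, (w u - 1) := by
    rw [intervalIntegral.integral_sub (h.intervalIntegrable _ _) (by simp), ← h.sub_eq, h.map_init]
    simp
  have hle : ∀ u, ‖w u - 1‖ ≤ Z.indicator w u := by
    intro u
    by_cases hu : u ∈ Z
    · rw [indicator_of_mem hu, Real.norm_eq_abs, abs_le]
      have := h.half_le u
      constructor <;> linarith
    · simp [indicator_of_notMem hu, hwZ u hu]
  have hind : Integrable (Z.indicator w) := (integrable_indicator_iff hZ).2 hint
  rw [h1, ← integral_indicator hZ, ← Real.norm_eq_abs]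
  refine intervalIntegral.norm_integral_le_integral_norm_uIoc.trans ?_
  refine (integral_mono_of_nonneg (ae_of_all _ fun _ => norm_nonneg _) hind.integrableOn
    (ae_of_all _ hle)).trans ?_
  exact setIntegral_le_integral hind (ae_of_all _ fun u => indicator_nonneg
    (fun v _ => (h.pos v).le) u)

theorem abs_symm_sub_le (h : TimeChange t w φ) {Z : Set ℝ} (hZ : MeasurableSet Z)
    (hwZ : ∀ x, x ∉ Z → w x = 1) (hint : IntegrableOn w Z) (s : ℝ) :
    |φ.symm s - s| ≤ ∫ u in Z, w u := by
  have := h.abs_sub_le hZ hwZ hint (φ.symm s)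
  rwa [φ.apply_symm_apply, abs_sub_comm] at this

theorem ae_deriv_comp_symm (h : TimeChange t w φ) (hT : T ≤ φ T) {y : ℝ → E n}
    (hy : AbsolutelyContinuousOnInterval y t T) (htT : t ≤ T) :
    ∀ᵐ s ∂(volI t T), deriv (y ∘ φ.symm) s = (w (φ.symm s))⁻¹ • deriv y (φ.symm s) := by
  have h1 := (ae_restrict_iff' measurableSet_Icc).1 (hy.ae_differentiableAt_euclidean htT)
  rw [ae_restrict_iff' measurableSet_Icc]
  filter_upwards [h.ae_comp_symm h1, h.ae_comp_symm h.ae_hasDerivAt] with s hs1 hs2 hs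
  have h3 : HasDerivAt φ.symm (w (φ.symm s))⁻¹ s :=
    HasDerivAt.of_local_left_inverse φ.symm.continuous.continuousAt hs2 (h.pos _).ne'
      (Eventually.of_forall fun x => φ.apply_symm_apply x)
  exact ((hs1 (h.symm_mem hT hs)).hasDerivAt.scomp s h3).deriv

/-- The increment of `y` between `φ⁻¹ a` and `φ⁻¹ b` is at most `L` times the integral of `w` there,
which is exactly `b - a`. -/
theorem lipschitzOnWith_comp_symm (h : TimeChange t w φ) (hT : T ≤ φ T) {y : ℝ → E n}
    (hy : AbsolutelyContinuousOnInterval y t T) (htT : t ≤ T) {L : ℝ≥0}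
    (hL : ∀ x ∈ Icc t T, ‖deriv y x‖ ≤ L * w x) :
    LipschitzOnWith L (y ∘ φ.symm) (Icc t T) := by
  have key : ∀ a ∈ Icc t T, ∀ b ∈ Icc t T, a ≤ b →
      dist (y (φ.symm b)) (y (φ.symm a)) ≤ L * dist b a := by
    intro a ha b hb hab
    have hle := h.symm_strictMono.monotone hab
    have ha' := h.symm_mem hT ha
    have hb' := h.symm_mem hT hb
    have h1 := (hy.mono (c := φ.symm a) (d := φ.symm b) (by
      rw [uIcc_of_le hle, uIcc_of_le htT]
      exact Icc_subset_Icc ha'.1 hb'.2)).norm_sub_le_integral hle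
        ((h.intervalIntegrable _ _).const_mul (L : ℝ))
        (fun x hx => hL x ⟨ha'.1.trans hx.1, hx.2.trans hb'.2⟩)
    rw [intervalIntegral.integral_const_mul, ← h.sub_eq, φ.apply_symm_apply,
      φ.apply_symm_apply] at h1
    rw [dist_eq_norm, Real.dist_eq, abs_of_nonneg (by linarith)]
    exact h1
  refine LipschitzOnWith.of_dist_le_mul fun a ha b hb => ?_
  rcases le_total a b with hab | hab
  · rw [dist_comm, dist_comm a b]
    exact key a ha b hb hab
  · exact key b hb a ha hab

end TimeChange

theorem IsLip.isW1p {p t T : ℝ} (htT : t ≤ T) {x : ℝ → E n} {L : ℝ≥0}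
    (hx : LipschitzOnWith L x (Icc t T)) : IsW1p p t T x := by
  have hne : ∀ c : ℝ, ∀ᵐ x : ℝ, x ≠ c := fun c => by simp [ae_iff, measure_singleton]
  refine ⟨?_, ?_, ?_⟩
  · exact LipschitzOnWith.absolutelyContinuousOnInterval (by rwa [uIcc_of_le htT])
  · have hc := hx.continuousOn
    obtain ⟨C, hC⟩ := isCompact_Icc.exists_bound_of_continuousOn hc
    exact MemLp.of_bound (hc.aestronglyMeasurable measurableSet_Icc) C
      ((ae_restrict_iff' measurableSet_Icc).2 (ae_of_all _ hC))
  · refine MemLp.of_bound (measurable_deriv x).aestronglyMeasurable L ?_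
    rw [ae_restrict_iff' measurableSet_Icc]
    filter_upwards [hne t, hne T] with s h1 h2 hs
    exact norm_deriv_le_of_lipschitzOn (Icc_mem_nhds (lt_of_le_of_ne hs.1 (Ne.symm h1))
      (lt_of_le_of_ne hs.2 h2)) hx

/-! ### Vanishing time changes and convergence in `W^{1,p}` -/

/-- A sequence of time changes `φ h` of speed `w h`, where `w h = 1` off the set `Z h ⊆ [t, T]`
and the mass of `w h` on `Z h` vanishes in the limit. -/
structure VanishingTimeChange (t T : ℝ) (w : ℕ → ℝ → ℝ) (φ : ℕ → ℝ ≃ₜ ℝ) (Z : ℕ → Set ℝ) :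
    Prop where
  timeChange : ∀ h, TimeChange t (w h) (φ h)
  le_apply : ∀ h, T ≤ φ h T
  measurableSet : ∀ h, MeasurableSet (Z h)
  subset : ∀ h, Z h ⊆ Icc t T
  eq_one : ∀ h, ∀ x, x ∉ Z h → w h x = 1
  integrableOn : ∀ h, IntegrableOn (w h) (Z h)
  tendsto_integral : Tendsto (fun h => ∫ x in Z h, w h x) atTop (𝓝 0)

namespace VanishingTimeChange

variable {t T : ℝ} {w : ℕ → ℝ → ℝ} {φ : ℕ → ℝ ≃ₜ ℝ} {Z : ℕ → Set ℝ}

theorem abs_sub_le (H : VanishingTimeChange t T w φ Z) (h : ℕ) (x : ℝ) :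
    |φ h x - x| ≤ ∫ x in Z h, w h x :=
  (H.timeChange h).abs_sub_le (H.measurableSet h) (H.eq_one h) (H.integrableOn h) x

theorem abs_symm_sub_le (H : VanishingTimeChange t T w φ Z) (h : ℕ) (x : ℝ) :
    |(φ h).symm x - x| ≤ ∫ x in Z h, w h x :=
  (H.timeChange h).abs_symm_sub_le (H.measurableSet h) (H.eq_one h) (H.integrableOn h) x

theorem setLIntegral_eq (H : VanishingTimeChange t T w φ Z) (h : ℕ) :
    ∫⁻ x in Z h, ENNReal.ofReal (w h x) = ENNReal.ofReal (∫ x in Z h, w h x) :=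
  (ofReal_integral_eq_lintegral_ofReal (H.integrableOn h)
    (ae_of_all _ fun x => ((H.timeChange h).pos x).le)).symm

theorem tendsto_ofReal_integral (H : VanishingTimeChange t T w φ Z) :
    Tendsto (fun h => ENNReal.ofReal (∫ x in Z h, w h x)) atTop (𝓝 0) := by
  simpa using ENNReal.tendsto_ofReal H.tendsto_integral

theorem volume_le (H : VanishingTimeChange t T w φ Z) (h : ℕ) :
    volume (Z h) ≤ 2 * ENNReal.ofReal (∫ x in Z h, w h x) := by
  rw [← H.setLIntegral_eq, ← lintegral_const_mul' _ _ (by simp), ← setLIntegral_one]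
  refine lintegral_mono fun x => ?_
  have := (H.timeChange h).half_le x
  rw [← ENNReal.ofReal_ofNat 2, ← ENNReal.ofReal_mul (by norm_num), ← ENNReal.ofReal_one]
  exact ENNReal.ofReal_le_ofReal (by linarith)

theorem tendsto_eLpNorm_comp_symm_sub (H : VanishingTimeChange t T w φ Z) {f : ℝ → E n}
    (hf : ContinuousOn f (Icc t T)) (q : ℝ≥0∞) :
    Tendsto (fun h => eLpNorm (fun s => f ((φ h).symm s) - f s) q (volI t T)) atTop (𝓝 0) := by
  set m := (volI t T) univ ^ q.toReal⁻¹ with hm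
  have hmtop : m ≠ ∞ := ENNReal.rpow_ne_top_of_nonneg (by positivity) (by simp)
  have huc := isCompact_Icc.uniformContinuousOn_of_continuous hf
  rw [Metric.uniformContinuousOn_iff_le] at huc
  have key : ∀ δ : ℝ, 0 < δ → ∀ᶠ h in atTop,
      eLpNorm (fun s => f ((φ h).symm s) - f s) q (volI t T) ≤ m * ENNReal.ofReal δ := by
    intro δ hδ
    obtain ⟨r, hr, hfr⟩ := huc δ hδ
    filter_upwards [H.tendsto_integral.eventually_le_const hr] with h hh
    refine eLpNorm_le_of_ae_bound ?_
    rw [ae_restrict_iff' measurableSet_Icc]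
    refine ae_of_all _ fun s hs => ?_
    rw [← dist_eq_norm]
    exact hfr _ ((H.timeChange h).symm_mem (H.le_apply h) hs) _ hs
      ((H.abs_symm_sub_le h s).trans hh)
  have hlim : Tendsto (fun δ : ℝ => m * ENNReal.ofReal δ) (𝓝[>] 0) (𝓝 0) := by
    have h1 : Tendsto (fun δ : ℝ => ENNReal.ofReal δ) (𝓝[>] 0) (𝓝 0) := by
      simpa using (ENNReal.tendsto_ofReal (tendsto_id (x := 𝓝 (0 : ℝ)))).mono_left
        nhdsWithin_le_nhds
    simpa using ENNReal.Tendsto.const_mul h1 (Or.inr hmtop)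
  rw [ENNReal.tendsto_nhds_zero]
  intro ε hε
  obtain ⟨δ, h1, h2⟩ := ((ENNReal.tendsto_nhds_zero.1 hlim ε hε).and self_mem_nhdsWithin).exists
  exact (key δ h2).mono fun h hh => hh.trans h1

/-- Composition with `φ⁻¹` is harmless for a bounded continuous `g` close to `y'` in `L^q`. The
remaining error `y'/w - g` is measured after substitution against `w dx`: on `Z` it is bounded and
the mass is small, off `Z` it is `y' - g`. -/
theorem tendsto_eLpNorm_deriv (H : VanishingTimeChange t T w φ Z) (htT : t ≤ T) {y : ℝ → E n}
    (hy : AbsolutelyContinuousOnInterval y t T) {q : ℝ≥0∞} (hq : 1 ≤ q) (hq' : q ≠ ∞)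
    (hLp : MemLp (deriv y) q (volI t T)) {C : ℝ}
    (hC : ∀ h, ∀ x ∈ Z h, ‖deriv y x‖ ≤ C * w h x) :
    Tendsto (fun h => eLpNorm (fun s => deriv (y ∘ (φ h).symm) s - deriv y s) q (volI t T))
      atTop (𝓝 0) := by
  rw [ENNReal.tendsto_nhds_zero]
  intro ε hε
  have hδ : ε / 4 ≠ 0 := (ENNReal.div_pos hε.ne' (by simp)).ne'
  obtain ⟨g, hg, -⟩ := hLp.exists_boundedContinuous_eLpNorm_sub_le hq' hδ
  have hq0 : 0 < q.toReal := ENNReal.toReal_pos (zero_lt_one.trans_le hq).ne' hq'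
  have h2lim : Tendsto (fun h => ENNReal.ofReal (∫ x in Z h, w h x) ^ q.toReal⁻¹ *
      ENNReal.ofReal (C + ‖g‖)) atTop (𝓝 0) := by
    have := H.tendsto_ofReal_integral.ennrpow_const q.toReal⁻¹
    rw [ENNReal.zero_rpow_of_pos (by positivity)] at this
    simpa using ENNReal.Tendsto.mul_const this (Or.inr (ENNReal.ofReal_ne_top (r := C + ‖g‖)))
  filter_upwards [ENNReal.tendsto_nhds_zero.1 h2lim _ (pos_iff_ne_zero.2 hδ),
    ENNReal.tendsto_nhds_zero.1 (H.tendsto_eLpNorm_comp_symm_sub g.continuous.continuousOn q) _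
      (pos_iff_ne_zero.2 hδ)] with h hh2 hh3
  have hφ := H.timeChange h
  have hmd : Measurable (deriv y) := measurable_deriv y
  set D : ℝ → E n := fun x => (w h x)⁻¹ • deriv y x - g x with hD
  have hDm : Measurable D :=
    (hφ.measurable.inv.smul hmd).sub g.continuous.measurable
  set ν := (volume.withDensity (fun x => ENNReal.ofReal (w h x))).restrict
    (Icc t ((φ h).symm T)) with hν
  have hνZ : ν (Z h) ≤ ENNReal.ofReal (∫ x in Z h, w h x) := by
    rw [← H.setLIntegral_eq, ← withDensity_apply _ (H.measurableSet h)]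
    exact Measure.restrict_apply_le _ _
  -- Off `Z` the density is `1`, and `φ⁻¹ T ≤ T`.
  have hνc : ν.restrict (Z h)ᶜ ≤ volI t T := by
    refine Measure.le_iff.2 fun s hs => ?_
    rw [hν, Measure.restrict_restrict (H.measurableSet h).compl, Measure.restrict_apply hs,
      Measure.restrict_apply hs, withDensity_apply _
        (hs.inter ((H.measurableSet h).compl.inter measurableSet_Icc)),
      setLIntegral_congr_fun (g := fun _ => 1)
        (hs.inter ((H.measurableSet h).compl.inter measurableSet_Icc))
        (fun x hx => by simp [H.eq_one h x hx.2.1]), setLIntegral_one]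
    refine measure_mono fun x hx => ⟨hx.1, hx.2.2.1, hx.2.2.2.trans ?_⟩
    exact hφ.symm_le (H.le_apply h)
  have hpart1 : eLpNorm ((Z h).indicator D) q ν ≤ ε / 4 := by
    rw [eLpNorm_indicator_eq_eLpNorm_restrict (H.measurableSet h)]
    refine le_trans (eLpNorm_le_of_ae_bound (C := C + ‖g‖) ?_) (le_trans ?_ hh2)
    · rw [ae_restrict_iff' (H.measurableSet h)]
      refine ae_of_all _ fun x hx => (norm_sub_le _ _).trans (add_le_add ?_ (g.norm_coe_le_norm x))
      rw [norm_smul, norm_inv, Real.norm_eq_abs, abs_of_pos (hφ.pos x),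
        inv_mul_le_iff₀ (hφ.pos x), mul_comm]
      exact hC h x hx
    · rw [Measure.restrict_apply_univ]
      gcongr
  have hpart2 : eLpNorm ((Z h)ᶜ.indicator D) q ν ≤ ε / 4 := by
    rw [eLpNorm_indicator_eq_eLpNorm_restrict (H.measurableSet h).compl]
    refine le_trans (le_of_eq (eLpNorm_congr_ae (g := deriv y - ⇑g) ?_))
      ((eLpNorm_mono_measure _ hνc).trans hg)
    filter_upwards [ae_restrict_mem (H.measurableSet h).compl] with x hx
    simp [hD, H.eq_one h x hx]
  have hDle : eLpNorm (fun s => D ((φ h).symm s)) q (volI t T) ≤ ε / 4 + ε / 4 := by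
    have h1 : eLpNorm (fun s => D ((φ h).symm s)) q (volI t T) = eLpNorm D q ν := by
      rw [hν, ← hφ.map_volI, eLpNorm_map_measure hDm.aestronglyMeasurable
        (φ h).symm.continuous.aemeasurable]
      rfl
    rw [h1]
    conv_lhs => rw [← indicator_self_add_compl (Z h) D]
    exact (eLpNorm_add_le (hDm.indicator (H.measurableSet h)).aestronglyMeasurable
      (hDm.indicator (H.measurableSet h).compl).aestronglyMeasurable hq).trans
        (add_le_add hpart1 hpart2)
  have hgy : eLpNorm (fun s => g s - deriv y s) q (volI t T) ≤ ε / 4 := by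
    refine le_trans (le_of_eq ?_) hg
    rw [← eLpNorm_neg]
    congr 1
    ext1 s
    simp
  have hsum : (fun s => deriv (y ∘ (φ h).symm) s - deriv y s) =ᵐ[volI t T]
      (fun s => D ((φ h).symm s)) +
        ((fun s => g ((φ h).symm s) - g s) + (fun s => g s - deriv y s)) := by
    filter_upwards [hφ.ae_deriv_comp_symm (H.le_apply h) hy htT] with s hs
    simp [hD, hs]
  have hgm := g.continuous.measurable
  have hψm := (φ h).symm.continuous.measurable
  rw [eLpNorm_congr_ae hsum]
  calc _ ≤ _ := eLpNorm_add_le (hDm.comp hψm).aestronglyMeasurable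
        (((hgm.comp hψm).sub hgm).add (hgm.sub hmd)).aestronglyMeasurable hq
    _ ≤ (ε / 4 + ε / 4) + (ε / 4 + ε / 4) := by
        refine add_le_add hDle ((eLpNorm_add_le ((hgm.comp hψm).sub hgm).aestronglyMeasurable
          (hgm.sub hmd).aestronglyMeasurable hq).trans (add_le_add hh3 hgy))
    _ = ε := by
        have : ε / 4 + ε / 4 = ε / 2 := by
          rw [ENNReal.div_add_div_same, ← two_mul, ← ENNReal.mul_div_mul_left ε 2 (c := 2)
            (by simp) (by simp)]
          norm_num
        rw [this, ENNReal.add_halves]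

end VanishingTimeChange

/-! ### Convergence of the energy -/

namespace VanishingTimeChange

variable {t T : ℝ} {w : ℕ → ℝ → ℝ} {φ : ℕ → ℝ ≃ₜ ℝ} {Z : ℕ → Set ℝ}

/-- Freezing the trajectory and its velocity and perturbing only the time variable is harmless:
this is where Condition (S) enters. -/
theorem tendsto_lintegral_projIcc (H : VanishingTimeChange t T w φ Z) {p : ℝ} (hp : 1 ≤ p)
    (htT : t ≤ T) {Λ : ℝ → E n → E n → ℝ≥0∞} {Ψ : ℝ → E n → ℝ≥0∞}
    (hΛm : Measurable (fun q : ℝ × E n × E n => Λ q.1 q.2.1 q.2.2))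
    (hΨm : Measurable (fun q : ℝ × E n => Ψ q.1 q.2))
    (hdom : ∃ D : Set (E n × E n), effDom t T Λ = Icc t T ×ˢ D)
    (hS : ConditionS p t T Λ) {y : ℝ → E n} (hy : IsW1p p t T y)
    {MΨ : ℝ≥0} (hMΨ : ∀ s ∈ Icc t T, ∀ x ∈ Icc t T, Ψ s (y x) ≤ MΨ)
    (hCΨ : ∀ x ∈ Icc t T, ContinuousOn (fun s => Ψ s (y x)) (Icc t T))
    (hΛ : ∫⁻ s in Icc t T, Λ s (y s) (deriv y s) < ∞) :
    ∃ (bound : ℝ → ℝ≥0∞) (N : ℕ), ∫⁻ x in Icc t T, bound x ≠ ∞ ∧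
      (∀ h, N ≤ h → ∀ᵐ x ∂(volI t T),
        Λ (projIcc t T htT (φ h x)) (y x) (deriv y x) * Ψ (projIcc t T htT (φ h x)) (y x) ≤
          bound x) ∧
      Tendsto (fun h => ∫⁻ x in Icc t T,
        Λ (projIcc t T htT (φ h x)) (y x) (deriv y x) * Ψ (projIcc t T htT (φ h x)) (y x))
        atTop (𝓝 (energy t T Λ Ψ y)) := by
  have hyc : ContinuousOn y (Icc t T) := by
    have := hy.absCont.continuousOn
    rwa [uIcc_of_le htT] at this
  have hym : AEMeasurable y (volI t T) := hyc.aemeasurable measurableSet_Icc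
  have hdm : AEMeasurable (deriv y) (volI t T) := (measurable_deriv y).aemeasurable
  obtain ⟨K, hK⟩ := isCompact_Icc.exists_bound_of_continuousOn hyc
  have hK0 : 0 ≤ K := (norm_nonneg _).trans (hK t (left_mem_Icc.2 htT))
  obtain ⟨κ, β, γ, ε, -, -, hγ, hε, hae⟩ := hS K hK0
  obtain ⟨D, hD⟩ := hdom
  have hproj : ∀ h, ∀ x ∈ Icc t T,
      |(projIcc t T htT (φ h x) : ℝ) - x| ≤ ∫ x in Z h, w h x := by
    intro h x hx
    have h1 : (x : ℝ) = projIcc t T htT x := by rw [projIcc_of_mem htT hx]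
    calc |(projIcc t T htT (φ h x) : ℝ) - x|
        = |(projIcc t T htT (φ h x) : ℝ) - projIcc t T htT x| := by rw [← h1]
      _ ≤ |φ h x - x| := abs_projIcc_sub_projIcc htT
      _ ≤ _ := H.abs_sub_le h x
  have hFm : ∀ h, AEMeasurable (fun x => Λ (projIcc t T htT (φ h x)) (y x) (deriv y x) *
      Ψ (projIcc t T htT (φ h x)) (y x)) (volI t T) := by
    intro h
    have h1 : AEMeasurable (fun x => (projIcc t T htT (φ h x) : ℝ)) (volI t T) :=
      (continuous_subtype_val.comp (continuous_projIcc.comp (φ h).continuous)).aemeasurable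
    exact (hΛm.comp_aemeasurable (h1.prodMk (hym.prodMk hdm))).mul
      (hΨm.comp_aemeasurable (h1.prodMk hym))
  set L : ℝ → ℝ≥0∞ := fun s => Λ s (y s) (deriv y s) with hL
  have hLm : AEMeasurable L (volI t T) :=
    hΛm.comp_aemeasurable (aemeasurable_id.prodMk (hym.prodMk hdm))
  set R : ℝ → ℝ := fun s => κ * (L s).toReal + β * ‖deriv y s‖ ^ p + γ s with hR
  have hRint : IntegrableOn R (Icc t T) := by
    refine (((integrable_toReal_of_lintegral_ne_top hLm hΛ.ne).const_mul κ).add ?_).add hγ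
    have := hy.memLp_deriv.integrable_norm_rpow (by simp; linarith) (by simp)
    rw [ENNReal.toReal_ofReal (by linarith)] at this
    exact this.const_mul β
  obtain ⟨N, hN⟩ := eventually_atTop.1 (H.tendsto_integral.eventually_le_const hε)
  have hfacts : ∀ᵐ x ∂(volI t T), x ∈ Icc t T ∧ ∀ h, N ≤ h →
      Λ (projIcc t T htT (φ h x)) (y x) (deriv y x) < ∞ ∧ L x < ∞ ∧
      |(Λ (projIcc t T htT (φ h x)) (y x) (deriv y x)).toReal - (L x).toReal| ≤
        R x * |(projIcc t T htT (φ h x) : ℝ) - x| := by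
    filter_upwards [hae, ae_restrict_mem measurableSet_Icc, ae_lt_top' hLm hΛ.ne] with x hx hm hLx
    refine ⟨hm, fun h hh => ?_⟩
    have hmem : (x, y x, deriv y x) ∈ effDom t T Λ := ⟨hm, hLx⟩
    set s := projIcc t T htT (φ h x) with hs
    -- The product form of the domain carries finiteness from time `x` to time `s`; without it the
    -- real-valued estimate would say nothing about an infinite value.
    have hmem2 : ((s : ℝ), y x, deriv y x) ∈ effDom t T Λ := by
      rw [hD] at hmem ⊢
      exact ⟨s.2, hmem.2⟩
    refine ⟨hmem2.2, hLx, hx x ⟨⟨by linarith, by linarith⟩, hm⟩ s ⟨?_, s.2⟩ (y x) (deriv y x)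
      (hK x hm) hmem⟩
    have := (hproj h x hm).trans (hN h hh)
    rw [abs_le] at this
    constructor <;> linarith [this.1, this.2]
  have hbd : ∀ h, N ≤ h → ∀ᵐ x ∂(volI t T),
      Λ (projIcc t T htT (φ h x)) (y x) (deriv y x) * Ψ (projIcc t T htT (φ h x)) (y x) ≤
        (L x + ENNReal.ofReal (|R x| * ε)) * MΨ := by
    intro h hh
    filter_upwards [hfacts] with x hx
    obtain ⟨hm, hx⟩ := hx
    obtain ⟨h1, h2, h3⟩ := hx h hh
    refine mul_le_mul' ?_ (hMΨ _ (projIcc t T htT (φ h x)).2 x hm)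
    rw [← ENNReal.ofReal_toReal h1.ne, ← ENNReal.ofReal_toReal h2.ne,
      ← ENNReal.ofReal_add ENNReal.toReal_nonneg (by positivity)]
    refine ENNReal.ofReal_le_ofReal ?_
    have h4 : R x * |(projIcc t T htT (φ h x) : ℝ) - x| ≤ |R x| * ε :=
      mul_le_mul (le_abs_self _) ((hproj h x hm).trans (hN h hh)) (abs_nonneg _) (abs_nonneg _)
    linarith [(abs_le.1 h3).2]
  have hfin : ∫⁻ x in Icc t T, (L x + ENNReal.ofReal (|R x| * ε)) * MΨ ≠ ∞ := by
    rw [lintegral_mul_const' _ _ ENNReal.coe_ne_top, lintegral_add_left' hLm]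
    exact ENNReal.mul_ne_top (ENNReal.add_ne_top.2 ⟨hΛ.ne,
      (hRint.abs.mul_const ε).lintegral_lt_top.ne⟩) ENNReal.coe_ne_top
  refine ⟨_, N, hfin, hbd, ?_⟩
  rw [← tendsto_add_atTop_iff_nat N]
  refine tendsto_lintegral_of_dominated_convergence' _ (fun h => hFm _)
    (fun h => hbd _ (Nat.le_add_left _ _)) hfin ?_
  filter_upwards [hfacts] with x hx
  obtain ⟨hm, hx⟩ := hx
  have hη : Tendsto (fun h => ∫ x in Z (h + N), w (h + N) x) atTop (𝓝 0) :=
    (tendsto_add_atTop_iff_nat N).2 H.tendsto_integral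
  have hd : Tendsto (fun h => |(projIcc t T htT (φ (h + N) x) : ℝ) - x|) atTop (𝓝 0) :=
    squeeze_zero (fun _ => abs_nonneg _) (fun h => hproj _ x hm) hη
  have hs : Tendsto (fun h => (projIcc t T htT (φ (h + N) x) : ℝ)) atTop (𝓝 x) :=
    tendsto_iff_dist_tendsto_zero.2 hd
  have hLx := (hx N le_rfl).2.1
  refine ENNReal.Tendsto.mul ?_ (Or.inr ?_) ?_ (Or.inr hLx.ne)
  · rw [← ENNReal.tendsto_toReal_iff (fun h => (hx _ (Nat.le_add_left _ _)).1.ne) hLx.ne,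
      tendsto_iff_dist_tendsto_zero]
    refine squeeze_zero (fun _ => dist_nonneg) (fun h => (hx _ (Nat.le_add_left _ _)).2.2) ?_
    simpa using hd.const_mul (R x)
  · exact ((hMΨ x hm x hm).trans_lt ENNReal.coe_lt_top).ne
  · exact (hCΨ x hm x hm).tendsto.comp
      (tendsto_nhdsWithin_iff.2 ⟨hs, Eventually.of_forall fun h => Subtype.property _⟩)

/-- After substitution the energy is an integral over `J = [t, φ⁻¹ T]`. The part on `Z` is at most
`M * MΨ` times the mass of `w`; the part off `Z` differs from the integral of `F h` over `[t, T]` by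
an integral `b h` over a set of vanishing measure, controlled by the common integrable bound. -/
theorem tendsto_energy (H : VanishingTimeChange t T w φ Z) {p : ℝ} (hp : 1 ≤ p)
    (htT : t ≤ T) {Λ : ℝ → E n → E n → ℝ≥0∞} {Ψ : ℝ → E n → ℝ≥0∞}
    (hΛm : Measurable (fun q : ℝ × E n × E n => Λ q.1 q.2.1 q.2.2))
    (hΨm : Measurable (fun q : ℝ × E n => Ψ q.1 q.2))
    (hdom : ∃ D : Set (E n × E n), effDom t T Λ = Icc t T ×ˢ D)
    (hS : ConditionS p t T Λ) {y : ℝ → E n} (hy : IsW1p p t T y)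
    {MΨ : ℝ≥0} (hMΨ : ∀ s ∈ Icc t T, ∀ x ∈ Icc t T, Ψ s (y x) ≤ MΨ)
    (hCΨ : ∀ x ∈ Icc t T, ContinuousOn (fun s => Ψ s (y x)) (Icc t T))
    (hΛ : ∫⁻ s in Icc t T, Λ s (y s) (deriv y s) < ∞) {M : ℝ≥0}
    (hM : ∀ h, ∀ x ∈ Z h, ∀ s ∈ Icc t T, Λ s (y x) ((w h x)⁻¹ • deriv y x) ≤ M) :
    Tendsto (fun h => energy t T Λ Ψ (y ∘ (φ h).symm)) atTop (𝓝 (energy t T Λ Ψ y)) := by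
  obtain ⟨bound, N, hfin, hbd, hlim⟩ :=
    H.tendsto_lintegral_projIcc hp htT hΛm hΨm hdom hS hy hMΨ hCΨ hΛ
  set F : ℕ → ℝ → ℝ≥0∞ := fun h x =>
    Λ (projIcc t T htT (φ h x)) (y x) (deriv y x) * Ψ (projIcc t T htT (φ h x)) (y x) with hF
  set G : ℕ → ℝ → ℝ≥0∞ := fun h x =>
    Λ (φ h x) (y x) ((w h x)⁻¹ • deriv y x) * Ψ (φ h x) (y x) with hG
  set J : ℕ → Set ℝ := fun h => Icc t ((φ h).symm T) with hJ
  have hJsub : ∀ h, J h ⊆ Icc t T := fun h =>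
    Icc_subset_Icc le_rfl ((H.timeChange h).symm_le (H.le_apply h))
  set b : ℕ → ℝ≥0∞ := fun h => ∫⁻ x in Icc t T \ (J h \ Z h), F h x with hb
  set c : ℕ → ℝ≥0∞ := fun h => ∫⁻ x in J h ∩ Z h, ENNReal.ofReal (w h x) * G h x with hc
  have hEn : ∀ h, energy t T Λ Ψ (y ∘ (φ h).symm) = c h + ∫⁻ x in J h \ Z h, F h x := by
    intro h
    have hφ := H.timeChange h
    have h1 : energy t T Λ Ψ (y ∘ (φ h).symm) = ∫⁻ s in Icc t T, G h ((φ h).symm s) := by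
      refine lintegral_congr_ae ?_
      filter_upwards [hφ.ae_deriv_comp_symm (H.le_apply h) hy.absCont htT] with s hs
      simp [hG, hs]
    rw [h1, hφ.setLIntegral_comp_symm, ← lintegral_inter_add_sdiff _ _ (H.measurableSet h)]
    congr 1
    refine setLIntegral_congr_fun (measurableSet_Icc.diff (H.measurableSet h)) fun x hx => ?_
    have h2 : (projIcc t T htT (φ h x) : ℝ) = φ h x := by
      rw [projIcc_of_mem htT (hφ.apply_mem hx.1)]
    simp only [hF, hG, h2, H.eq_one h x hx.2]
    simp
  have hsplit : ∀ h, ∫⁻ x in Icc t T, F h x = (∫⁻ x in J h \ Z h, F h x) + b h := by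
    intro h
    rw [← lintegral_inter_add_sdiff _ (Icc t T) (measurableSet_Icc.diff (H.measurableSet h)),
      inter_eq_right.2 (sdiff_subset.trans (hJsub h))]
  have hvol : Tendsto ((volI t T) ∘ fun h => Icc t T \ (J h \ Z h)) atTop (𝓝 0) := by
    have h0 : Tendsto (fun h => 3 * ENNReal.ofReal (∫ x in Z h, w h x)) atTop (𝓝 0) := by
      simpa using ENNReal.Tendsto.const_mul H.tendsto_ofReal_integral
        (Or.inr (ENNReal.ofNat_ne_top (n := 3)))
    refine tendsto_of_tendsto_of_tendsto_of_le_of_le tendsto_const_nhds h0 (fun _ => zero_le)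
      fun h => ?_
    have hsub : Icc t T \ (J h \ Z h) ⊆ Z h ∪ Icc ((φ h).symm T) T := by
      intro x hx
      by_cases hxZ : x ∈ Z h
      · exact Or.inl hxZ
      · refine Or.inr ⟨?_, hx.1.2⟩
        by_contra hlt
        exact hx.2 ⟨⟨hx.1.1, (not_le.1 hlt).le⟩, hxZ⟩
    calc (volI t T) (Icc t T \ (J h \ Z h)) ≤ volume (Z h ∪ Icc ((φ h).symm T) T) :=
          (Measure.restrict_apply_le _ _).trans (measure_mono hsub)
      _ ≤ volume (Z h) + volume (Icc ((φ h).symm T) T) := measure_union_le _ _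
      _ ≤ 2 * ENNReal.ofReal (∫ x in Z h, w h x) + ENNReal.ofReal (∫ x in Z h, w h x) := by
          refine add_le_add (H.volume_le h) ?_
          rw [Real.volume_Icc]
          refine ENNReal.ofReal_le_ofReal ?_
          have := H.abs_symm_sub_le h T
          rw [abs_le] at this
          linarith [this.1]
      _ = 3 * ENNReal.ofReal (∫ x in Z h, w h x) := by ring
  have hble : ∀ h, N ≤ h → b h ≤ ∫⁻ x in Icc t T \ (J h \ Z h), bound x ∂(volI t T) := by
    intro h hh
    have hms : MeasurableSet (Icc t T \ (J h \ Z h)) :=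
      measurableSet_Icc.diff (measurableSet_Icc.diff (H.measurableSet h))
    rw [Measure.restrict_restrict hms, inter_eq_left.2 sdiff_subset]
    exact lintegral_mono_ae (ae_restrict_of_ae_restrict_of_subset sdiff_subset (hbd h hh))
  have hblim : Tendsto b atTop (𝓝 0) := by
    refine tendsto_of_tendsto_of_tendsto_of_le_of_le' tendsto_const_nhds
      (tendsto_setLIntegral_zero hfin hvol) (Eventually.of_forall fun _ => zero_le) ?_
    filter_upwards [eventually_ge_atTop N] with h hh using hble h hh
  have hclim : Tendsto c atTop (𝓝 0) := by
    have h0 : Tendsto (fun h => ENNReal.ofReal (∫ x in Z h, w h x) * ((M : ℝ≥0∞) * MΨ))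
        atTop (𝓝 0) := by
      simpa using ENNReal.Tendsto.mul_const H.tendsto_ofReal_integral
        (Or.inr (ENNReal.mul_ne_top (ENNReal.coe_ne_top (r := M)) (ENNReal.coe_ne_top (r := MΨ))))
    refine tendsto_of_tendsto_of_tendsto_of_le_of_le tendsto_const_nhds h0 (fun _ => zero_le)
      fun h => ?_
    rw [← H.setLIntegral_eq, ← lintegral_mul_const' _ _
      (ENNReal.mul_ne_top ENNReal.coe_ne_top ENNReal.coe_ne_top)]
    refine (setLIntegral_mono' (measurableSet_Icc.inter (H.measurableSet h)) fun x hx => ?_).trans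
      (lintegral_mono_set inter_subset_right)
    have hm := (H.timeChange h).apply_mem hx.1
    exact mul_le_mul' le_rfl (mul_le_mul' (hM h x hx.2 _ hm) (hMΨ _ hm x (hJsub h hx.1)))
  -- Finiteness makes the subtraction of `b h` in `[0, ∞]` exact.
  have hbtop : ∀ᶠ h in atTop, b h ≠ ∞ := by
    filter_upwards [eventually_ge_atTop N] with h hh
    exact (lt_of_le_of_lt ((hble h hh).trans (setLIntegral_le_lintegral _ _))
      (lt_top_iff_ne_top.2 hfin)).ne
  have hfinal : Tendsto (fun h => c h + (∫⁻ x in Icc t T, F h x) - b h) atTop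
      (𝓝 (energy t T Λ Ψ y)) := by
    simpa using ENNReal.Tendsto.sub (hclim.add hlim) hblim (Or.inr ENNReal.zero_ne_top)
  refine hfinal.congr' ?_
  filter_upwards [hbtop] with h hh
  rw [hEn, hsplit, ← add_assoc, ENNReal.add_sub_cancel_right hh]

theorem noLavrentievGap (H : VanishingTimeChange t T w φ Z) {p : ℝ} (hp : 1 ≤ p)
    (htT : t ≤ T) {Λ : ℝ → E n → E n → ℝ≥0∞} {Ψ : ℝ → E n → ℝ≥0∞}
    (hbasic : BasicAssumptions t T Λ Ψ)
    (hS : ConditionS p t T Λ) {y : ℝ → E n} (hy : IsW1p p t T y)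
    {MΨ : ℝ≥0} (hMΨ : ∀ s ∈ Icc t T, ∀ x ∈ Icc t T, Ψ s (y x) ≤ MΨ)
    (hCΨ : ∀ x ∈ Icc t T, ContinuousOn (fun s => Ψ s (y x)) (Icc t T))
    (hΛ : ∫⁻ s in Icc t T, Λ s (y s) (deriv y s) < ∞) {M : ℝ≥0}
    (hM : ∀ h, ∀ x ∈ Z h, ∀ s ∈ Icc t T, Λ s (y x) ((w h x)⁻¹ • deriv y x) ≤ M)
    {C : ℝ} (hC : ∀ h, ∀ x ∈ Z h, ‖deriv y x‖ ≤ C * w h x)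
    {L : ℕ → ℝ≥0} (hL : ∀ h, ∀ x ∈ Icc t T, ‖deriv y x‖ ≤ L h * w h x)
    {Γ : Set (ℝ → E n)} (hΓ : ∀ h, IsW1p p t T (y ∘ (φ h).symm) → y ∘ (φ h).symm ∈ Γ) :
    NoLavrentievGap p t T Λ Ψ Γ y := by
  have hLip : ∀ h, LipschitzOnWith (L h) (y ∘ (φ h).symm) (Icc t T) := fun h =>
    (H.timeChange h).lipschitzOnWith_comp_symm (H.le_apply h) hy.absCont htT (hL h)
  refine ⟨fun h => y ∘ (φ h).symm, fun h => ⟨⟨L h, hLip h⟩, hΓ h (IsLip.isW1p htT (hLip h))⟩,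
    ?_, ?_⟩
  -- `Λ` and `Ψ` are Borel only for times in `I`; freezing them outside `I` makes them Borel on the
  -- whole space without changing the energy.
  · set P : ℝ → Icc t T := projIcc t T htT with hP
    have hPm : Measurable P := continuous_projIcc.measurable
    have hPI : ∀ s ∈ Icc t T, (P s : ℝ) = s := fun s hs => by rw [hP, projIcc_of_mem htT hs]
    set Λ' : ℝ → E n → E n → ℝ≥0∞ := fun s => Λ (P s) with hΛ'
    set Ψ' : ℝ → E n → ℝ≥0∞ := fun s => Ψ (P s) with hΨ'
    have hΛe : ∀ s ∈ Icc t T, Λ' s = Λ s := fun s hs => by simp only [hΛ', hPI s hs]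
    have hΨe : ∀ s ∈ Icc t T, Ψ' s = Ψ s := fun s hs => by simp only [hΨ', hPI s hs]
    have hen : ∀ x : ℝ → E n, energy t T Λ Ψ x = energy t T Λ' Ψ' x := fun x =>
      setLIntegral_congr_fun measurableSet_Icc fun s hs => by simp only [hΛe s hs, hΨe s hs]
    have hdomeq : effDom t T Λ' = effDom t T Λ := by
      ext q
      refine and_congr_right fun hq => ?_
      rw [hΛe _ hq]
    simp only [hen]
    refine H.tendsto_energy hp htT ?_ ?_ (hdomeq ▸ hbasic.effDom_eq) ?_ hy (MΨ := MΨ) (M := M)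
      ?_ ?_ ?_ ?_
    · exact hbasic.measurable_Λ.comp
        ((hPm.comp measurable_fst).prodMk measurable_snd)
    · exact hbasic.measurable_Ψ.comp
        ((hPm.comp measurable_fst).prodMk measurable_snd)
    · intro K hK
      obtain ⟨κ, β, γ, ε, h1, h2, h3, h4, h5⟩ := hS K hK
      refine ⟨κ, β, γ, ε, h1, h2, h3, h4, ?_⟩
      filter_upwards [h5, ae_restrict_mem measurableSet_Icc] with s hs hm s₁ hs₁ s₂ hs₂ z v hz hd
      rw [hΛe _ hm, hΛe _ hs₁.2, hΛe _ hs₂.2]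
      exact hs s₁ hs₁ s₂ hs₂ z v hz (hdomeq ▸ hd)
    · intro s hs x hx
      rw [hΨe s hs]
      exact hMΨ s hs x hx
    · intro x hx
      exact (hCΨ x hx).congr fun s hs => by rw [hΨe s hs]
    · rwa [setLIntegral_congr_fun (g := fun s => Λ s (y s) (deriv y s)) measurableSet_Icc
        fun s hs => by simp only [hΛe s hs]]
    · intro h x hx s hs
      rw [hΛe s hs]
      exact hM h x hx s hs
  · have hyc : ContinuousOn y (Icc t T) := by
      have := hy.absCont.continuousOn
      rwa [uIcc_of_le htT] at this
    simpa [distW1p] using (H.tendsto_eLpNorm_comp_symm_sub hyc (ENNReal.ofReal p)).add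
      (H.tendsto_eLpNorm_deriv htT hy.absCont (by simpa using hp) ENNReal.ofReal_ne_top
        hy.memLp_deriv hC)

end VanishingTimeChange

/-! ### Construction of the time changes -/

theorem tendsto_setIntegral_superlevel {g : ℝ → ℝ} {I : Set ℝ} (hI : MeasurableSet I)
    (hg : Measurable g) (f : ℝ → ℝ) (hf : IntegrableOn f I) (r : ℝ) :
    Tendsto (fun h : ℕ => ∫ x in I ∩ {x | r + h < g x}, f x) atTop (𝓝 0) := by
  have h0 : ⋂ h : ℕ, I ∩ {x | r + h < g x} = ∅ := by
    refine eq_empty_of_forall_notMem fun x hx => ?_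
    obtain ⟨k, hk⟩ := exists_nat_gt (g x - r)
    have := (mem_iInter.1 hx k).2
    rw [mem_ofPred_eq] at this
    linarith
  have := tendsto_setIntegral_of_antitone (μ := volume) (f := f)
    (s := fun h : ℕ => I ∩ {x | r + h < g x})
    (fun h => hI.inter (measurableSet_lt measurable_const hg))
    (fun i j hij x hx => ⟨hx.1, lt_of_le_of_lt
      (show r + (i : ℝ) ≤ r + j by gcongr) hx.2⟩) ⟨0, hf.mono_set inter_subset_left⟩
  simpa [h0] using this

/-- Intermediate value theorem for `a ↦ |B ∩ (t, a]|`. -/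
theorem exists_subset_volume_real_eq {B : Set ℝ} {t T : ℝ} (htT : t ≤ T) (hB : MeasurableSet B)
    (hsub : B ⊆ Icc t T) {r : ℝ} (h0 : 0 ≤ r) (hr : r ≤ volume.real B) :
    ∃ S ⊆ B, MeasurableSet S ∧ volume.real S = r := by
  have hBfin : volume B ≠ ∞ := ((measure_mono hsub).trans_lt (by simp)).ne
  have hint : Integrable (B.indicator (fun _ => (1 : ℝ))) :=
    (integrable_indicator_iff hB).2 (integrableOn_const hBfin)
  have hcont : Continuous (fun a => ∫ x in t..a, B.indicator (fun _ => (1 : ℝ)) x) :=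
    intervalIntegral.continuous_primitive (fun _ _ => hint.intervalIntegrable) t
  have hval : ∀ a, t ≤ a → ∫ x in t..a, B.indicator (fun _ => (1 : ℝ)) x =
      volume.real (B ∩ Ioc t a) := by
    intro a ha
    rw [intervalIntegral.integral_of_le ha, setIntegral_indicator hB, inter_comm]
    simp
  have hT : volume.real (B ∩ Ioc t T) = volume.real B := by
    refine measureReal_congr ?_
    have : (B ∩ Ioc t T : Set ℝ) =ᵐ[volume] (B ∩ Icc t T : Set ℝ) :=
      (ae_eq_refl B).inter Ioc_ae_eq_Icc
    rwa [inter_eq_left.2 hsub] at this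
  obtain ⟨a, ha, hav⟩ := intermediate_value_Icc htT hcont.continuousOn
    (show r ∈ Icc _ _ from ⟨by simpa using h0, by rw [hval T htT, hT]; exact hr⟩)
  exact ⟨B ∩ Ioc t a, inter_subset_left, hB.inter measurableSet_Ioc, by
    rw [← hval a ha.1]; exact hav⟩

/-- The excess time needed to run through the points of `[t, T]` of speed `g > r` at speed `ν`. -/
def excess (t T ν : ℝ) (g : ℝ → ℝ) (r : ℝ) : ℝ :=
  ∫ x in Icc t T ∩ {x | r < g x}, (g x / ν - 1)

open Classical in
/-- The factor by which time is stretched: the points where `g > r` are run through at speed `ν`,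
and those of `S` at twice the original speed. -/
def stretch (t T ν : ℝ) (g : ℝ → ℝ) (r : ℝ) (S : Set ℝ) (x : ℝ) : ℝ :=
  if x ∈ Icc t T ∩ {x | r < g x} then g x / ν else if x ∈ S then 1 / 2 else 1

theorem stretch_of_lt {t T ν r : ℝ} {g : ℝ → ℝ} {S : Set ℝ} {x : ℝ}
    (hx : x ∈ Icc t T ∩ {x | r < g x}) : stretch t T ν g r S x = g x / ν :=
  if_pos hx

theorem stretch_of_mem {t T ν r : ℝ} {g : ℝ → ℝ} {S : Set ℝ} {x : ℝ}
    (hx : x ∉ Icc t T ∩ {x | r < g x}) (hS : x ∈ S) : stretch t T ν g r S x = 1 / 2 :=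
  (if_neg hx).trans (if_pos hS)

theorem stretch_of_notMem {t T ν r : ℝ} {g : ℝ → ℝ} {S : Set ℝ} {x : ℝ}
    (hx : x ∉ Icc t T ∩ {x | r < g x}) (hS : x ∉ S) : stretch t T ν g r S x = 1 :=
  (if_neg hx).trans (if_neg hS)

theorem exists_vanishingTimeChange {t T ν r : ℝ} (htT : t ≤ T) (hν : 0 < ν) (hr : ν ≤ r)
    {g : ℝ → ℝ} (hg : Measurable g) (hint : IntegrableOn g (Icc t T)) {S : ℕ → Set ℝ}
    (hSm : ∀ h, MeasurableSet (S h)) (hSI : ∀ h, S h ⊆ Icc t T)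
    (hSg : ∀ h, ∀ x ∈ S h, g x ≤ r + h)
    (hS : ∀ h : ℕ, volume.real (S h) / 2 ≤ excess t T ν g (r + h)) :
    ∃ φ : ℕ → ℝ ≃ₜ ℝ,
      VanishingTimeChange t T (fun h => stretch t T ν g (r + h) (S h)) φ
        (fun h => (Icc t T ∩ {x | r + h < g x}) ∪ S h) ∧
      ∀ h : ℕ, φ h T = T + excess t T ν g (r + h) - volume.real (S h) / 2 := by
  set A : ℕ → Set ℝ := fun h => Icc t T ∩ {x | r + h < g x} with hA
  set w : ℕ → ℝ → ℝ := fun h => stretch t T ν g (r + h) (S h) with hw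
  have hAm : ∀ h, MeasurableSet (A h) := fun h =>
    measurableSet_Icc.inter (measurableSet_lt measurable_const hg)
  have hdisj : ∀ h, Disjoint (A h) (S h) := fun h =>
    disjoint_left.2 fun x hx hxS => not_lt.2 (hSg h x hxS) hx.2
  have hwA : ∀ h, ∀ x ∈ A h, w h x = g x / ν := fun h x hx => stretch_of_lt hx
  have hwS : ∀ h, ∀ x ∈ S h, w h x = 1 / 2 := fun h x hx =>
    stretch_of_mem (fun h' => disjoint_left.1 (hdisj h) h' hx) hx
  have hw1 : ∀ h, ∀ x, x ∉ A h ∪ S h → w h x = 1 := fun h x hx =>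
    stretch_of_notMem (fun h' => hx (Or.inl h')) (fun h' => hx (Or.inr h'))
  have hgA : ∀ h, ∀ x ∈ A h, 1 ≤ g x / ν := fun h x hx => by
    rw [one_le_div hν]
    have h1 : r + h < g x := hx.2
    have : (0 : ℝ) ≤ h := Nat.cast_nonneg h
    linarith
  have hwm : ∀ h, Measurable (w h) := fun h =>
    Measurable.ite (hAm h) (hg.div_const ν)
      (Measurable.ite (hSm h) measurable_const measurable_const)
  have hhalf : ∀ h x, 1 / 2 ≤ w h x := by
    intro h x
    by_cases hx : x ∈ A h
    · rw [hwA h x hx]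
      linarith [hgA h x hx]
    · by_cases hxS : x ∈ S h
      · exact (hwS h x hxS).ge
      · rw [hw1 h x (by simp [hx, hxS])]
        norm_num
  have hSfin : ∀ h, volume (S h) ≠ ∞ := fun h =>
    ((measure_mono (hSI h)).trans_lt (by simp)).ne
  have hAfin : ∀ h, volume (A h) ≠ ∞ := fun h =>
    ((measure_mono inter_subset_left).trans_lt (by simp)).ne
  have hgAint : ∀ h, IntegrableOn g (A h) := fun h => hint.mono_set inter_subset_left
  have hdec : ∀ h x, w h x = 1 + ((A h).indicator (fun x => g x / ν - 1) x -
      (S h).indicator (fun _ => (1 / 2 : ℝ)) x) := by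
    intro h x
    by_cases hx : x ∈ A h
    · have hxS := disjoint_left.1 (hdisj h) hx
      rw [hwA h x hx, indicator_of_mem hx, indicator_of_notMem hxS]
      ring
    · by_cases hxS : x ∈ S h
      · rw [hwS h x hxS, indicator_of_notMem hx, indicator_of_mem hxS]
        norm_num
      · rw [hw1 h x (by simp [hx, hxS]), indicator_of_notMem hx, indicator_of_notMem hxS]
        norm_num
  have hI1 : ∀ h, Integrable ((A h).indicator (fun x => g x / ν - 1)) := fun h =>
    (integrable_indicator_iff (hAm h)).2
      (((hgAint h).div_const ν).sub (integrableOn_const (hAfin h)))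
  have hI2 : ∀ h, Integrable ((S h).indicator (fun _ => (1 / 2 : ℝ))) := fun h =>
    (integrable_indicator_iff (hSm h)).2 (integrableOn_const (hSfin h))
  have hloc : ∀ h, LocallyIntegrable (w h) := by
    intro h
    have : w h = fun x => 1 + ((A h).indicator (fun x => g x / ν - 1) x -
      (S h).indicator (fun _ => (1 / 2 : ℝ)) x) := funext (hdec h)
    rw [this]
    exact (locallyIntegrable_const 1).add ((hI1 h).sub (hI2 h)).locallyIntegrable
  choose φ hφ using fun h => exists_timeChange t (hwm h) (hhalf h) (hloc h)
  have hφT : ∀ h : ℕ, φ h T = T + excess t T ν g (r + h) - volume.real (S h) / 2 := by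
    intro h
    have h1 := (hφ h).sub_eq t T
    rw [(hφ h).map_init, intervalIntegral.integral_congr (fun x _ => hdec h x),
      intervalIntegral.integral_add (f := fun _ => 1)
        (g := fun x => (A h).indicator (fun x => g x / ν - 1) x -
          (S h).indicator (fun _ => (1 / 2 : ℝ)) x) (by simp) ((hI1 h).sub (hI2 h)).intervalIntegrable,
      intervalIntegral.integral_sub (hI1 h).intervalIntegrable (hI2 h).intervalIntegrable,
      intervalIntegral.integral_of_le htT, intervalIntegral.integral_of_le htT,
      intervalIntegral.integral_of_le htT,
      ← integral_Icc_eq_integral_Ioc, ← integral_Icc_eq_integral_Ioc,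
      ← integral_Icc_eq_integral_Ioc, setIntegral_indicator (hAm h),
      setIntegral_indicator (hSm h), inter_eq_right.2 (hSI h),
      inter_eq_right.2 (show A h ⊆ Icc t T from inter_subset_left)] at h1
    have h2 : ∫ x in A h, (g x / ν - 1) = excess t T ν g (r + h) := rfl
    rw [h2] at h1
    simp [htT] at h1
    linarith
  have hintw : ∀ h, IntegrableOn (w h) (A h ∪ S h) := by
    intro h
    refine ((hloc h).integrableOn_isCompact (isCompact_Icc (a := t) (b := T))).mono_set ?_
    exact union_subset inter_subset_left (hSI h)
  have hZint : ∀ h, ∫ x in A h ∪ S h, w h x = (∫ x in A h, g x / ν) + volume.real (S h) / 2 := by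
    intro h
    rw [setIntegral_union (hdisj h) (hSm h) ((hintw h).mono_set subset_union_left)
      ((hintw h).mono_set subset_union_right), setIntegral_congr_fun (hAm h) (hwA h),
      setIntegral_congr_fun (hSm h) (hwS h)]
    simp
    ring
  refine ⟨φ, ⟨hφ, fun h => ?_, fun h => (hAm h).union (hSm h),
    fun h => union_subset inter_subset_left (hSI h), hw1, hintw, ?_⟩, hφT⟩
  · rw [hφT]
    linarith [hS h]
  · have h1 := tendsto_setIntegral_superlevel measurableSet_Icc hg (fun x => g x / ν)
      (hint.div_const ν) r
    have h2 := h1.const_mul 2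
    rw [mul_zero] at h2
    refine squeeze_zero (fun h => ?_) (fun h => ?_) h2
    · exact integral_nonneg fun x => ((hφ h).pos x).le
    -- The mass on `Z` is the integral of `g / ν` over `A` plus `|S| / 2`, and `|S| / 2 ≤ excess` is
    -- at most that same integral: hence the factor `2`.
    · rw [hZint h]
      have h3 : excess t T ν g (r + h) ≤ ∫ x in A h, g x / ν := by
        refine integral_mono_ae (((hgAint h).div_const ν).sub (integrableOn_const (hAfin h)))
          ((hgAint h).div_const ν) (ae_of_all _ fun x => ?_)
        simp
      have h4 : ∫ x in A h, g x / ν = ∫ x in Icc t T ∩ {x | r + h < g x}, g x / ν := rfl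
      linarith [hS h]

theorem excess_nonneg {t T ν r : ℝ} (hν : 0 < ν) (hr : ν ≤ r) {g : ℝ → ℝ} (hg : Measurable g) :
    0 ≤ excess t T ν g r := by
  refine setIntegral_nonneg (measurableSet_Icc.inter (measurableSet_lt measurable_const hg))
    fun x hx => ?_
  have : r < g x := hx.2
  rw [sub_nonneg, one_le_div hν]
  linarith

/-- The common core of both parts. With `S h = ∅` it handles the initial end-point condition. -/
theorem noLavrentievGap_of_stretch {p t T ν r c : ℝ} (hp : 1 ≤ p) (htT : t ≤ T) (hν : 0 < ν)
    (hr : ν ≤ r) {Λ : ℝ → E n → E n → ℝ≥0∞} {Ψ : ℝ → E n → ℝ≥0∞}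
    (hbasic : BasicAssumptions t T Λ Ψ)
    (hS : ConditionS p t T Λ) {y : ℝ → E n} (hy : IsW1p p t T y)
    {MΨ : ℝ≥0} (hMΨ : ∀ s ∈ Icc t T, ∀ x ∈ Icc t T, Ψ s (y x) ≤ MΨ)
    (hCΨ : ∀ x ∈ Icc t T, ContinuousOn (fun s => Ψ s (y x)) (Icc t T))
    (hΛ : ∫⁻ s in Icc t T, Λ s (y s) (deriv y s) < ∞)
    {M₁ : ℝ≥0} (hM₁ : ∀ s ∈ Icc t T, ∀ x ∈ Icc t T, ∀ v : E n, ‖v‖ ≤ ν → Λ s (y x) v ≤ M₁)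
    {S : ℕ → Set ℝ} (hSm : ∀ h, MeasurableSet (S h)) (hSI : ∀ h, S h ⊆ Icc t T)
    (hSc : ∀ h, ∀ x ∈ S h, ‖deriv y x‖ ≤ c) (hcr : c ≤ r)
    {M₂ : ℝ≥0} (hM₂ : ∀ h, ∀ x ∈ S h, ∀ s ∈ Icc t T, ∀ v : E n, ‖v‖ ≤ 2 * c → Λ s (y x) v ≤ M₂)
    (hSvol : ∀ h : ℕ, volume.real (S h) / 2 ≤ excess t T ν (fun x => ‖deriv y x‖) (r + h))
    {Γ : Set (ℝ → E n)} (hΓ : ∀ (h : ℕ) (ψ : ℝ → ℝ), ψ t = t →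
      (volume.real (S h) / 2 = excess t T ν (fun x => ‖deriv y x‖) (r + h) → ψ T = T) →
      IsW1p p t T (y ∘ ψ) → y ∘ ψ ∈ Γ) :
    NoLavrentievGap p t T Λ Ψ Γ y := by
  have hgm : Measurable (fun x => ‖deriv y x‖) := (measurable_deriv y).norm
  have hgint : IntegrableOn (fun x => ‖deriv y x‖) (Icc t T) :=
    (hy.memLp_deriv.integrable (by simpa using hp)).norm
  have hnat : ∀ h : ℕ, (0 : ℝ) ≤ h := fun h => Nat.cast_nonneg h
  obtain ⟨φ, H, hφT⟩ := exists_vanishingTimeChange htT hν hr hgm hgint hSm hSI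
    (fun h x hx => (hSc h x hx).trans (by linarith [hnat h])) hSvol
  have hSA : ∀ h : ℕ, ∀ x ∈ S h, x ∉ Icc t T ∩ {x | r + h < ‖deriv y x‖} := by
    intro h x hx hxA
    have h1 : r + h < ‖deriv y x‖ := hxA.2
    linarith [hSc h x hx, hnat h]
  have hrh : ∀ h : ℕ, 0 ≤ 2 * (r + h) := fun h => by linarith [hnat h]
  -- On `A`, `|y'| = ν w`; on `S`, `|y'| ≤ c = 2c · w`: this gives `C`. Off `A`, `|y'| ≤ r + h` and
  -- `w ≥ 1/2`, whence the factor `2` in `L`.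
  refine H.noLavrentievGap hp htT hbasic hS hy hMΨ hCΨ hΛ (M := max M₁ M₂) ?_
    (C := max ν (2 * c)) ?_ (L := fun h => ⟨2 * (r + h), hrh h⟩) ?_ ?_
  · rintro h x (hx | hx) s hs
    · refine (hM₁ s hs x hx.1 _ ?_).trans (by exact_mod_cast le_max_left _ _)
      have h1 : r + h < ‖deriv y x‖ := hx.2
      have h2 : 0 < ‖deriv y x‖ := by linarith [hnat h]
      rw [stretch_of_lt hx, norm_smul, norm_inv, norm_div, norm_norm, Real.norm_eq_abs,
        abs_of_pos hν, inv_div, div_mul_cancel₀ _ h2.ne']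
    · refine (hM₂ h x hx s hs _ ?_).trans (by exact_mod_cast le_max_right _ _)
      rw [stretch_of_mem (hSA h x hx) hx, norm_smul]
      norm_num
      exact hSc h x hx
  · rintro h x (hx | hx)
    · rw [stretch_of_lt hx]
      calc ‖deriv y x‖ = ν * (‖deriv y x‖ / ν) := by field_simp
        _ ≤ _ := by gcongr; exact le_max_left _ _
    · rw [stretch_of_mem (hSA h x hx) hx]
      linarith [hSc h x hx, le_max_right ν (2 * c)]
  · intro h x hx
    change ‖deriv y x‖ ≤ 2 * (r + h) * _
    by_cases hxA : x ∈ Icc t T ∩ {x | r + h < ‖deriv y x‖}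
    · rw [stretch_of_lt hxA]
      calc ‖deriv y x‖ = ν * (‖deriv y x‖ / ν) := by field_simp
        _ ≤ _ := by gcongr; linarith [hnat h]
    · have h1 : ‖deriv y x‖ ≤ r + h := by
        by_contra hlt
        exact hxA ⟨hx, not_le.1 hlt⟩
      have h2 := (H.timeChange h).half_le x
      nlinarith [hrh h]
  · intro h hW
    refine hΓ h _ (H.timeChange h).symm_init (fun he => ?_) hW
    rw [Homeomorph.symm_apply_eq, hφT, he]
    ring

/-! ### Room for recovering time, and the theorem -/

theorem exists_Icc_mapsTo {t T : ℝ} (htT : t < T) {y : ℝ → E n} (hy : ContinuousOn y (Icc t T))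
    {V : Set (E n)} (hV : IsOpen V) (hne : (V ∩ y '' Icc t T).Nonempty) :
    ∃ a b, a < b ∧ Icc a b ⊆ Icc t T ∧ ∀ x ∈ Icc a b, y x ∈ V := by
  obtain ⟨_, hxV, x, hx, rfl⟩ := hne
  obtain ⟨δ, hδ, hsub⟩ := Metric.mem_nhdsWithin_iff.1 ((hy x hx).preimage_mem_nhdsWithin
    (hV.mem_nhds hxV))
  have h1 : max t (x - δ / 2) < min T (x + δ / 2) := by
    rw [max_lt_iff, lt_min_iff, lt_min_iff]
    refine ⟨⟨htT, ?_⟩, ?_, ?_⟩ <;> linarith [hx.1, hx.2]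
  refine ⟨_, _, h1, Icc_subset_Icc (le_max_left _ _) (min_le_left _ _), fun s hs => ?_⟩
  refine hsub ⟨?_, (le_max_left _ _).trans hs.1, hs.2.trans (min_le_left _ _)⟩
  have h2 := (le_max_right _ _).trans hs.1
  have h3 := hs.2.trans (min_le_right _ _)
  rw [Metric.mem_ball, Real.dist_eq, abs_lt]
  constructor <;> linarith

theorem exists_nat_volume_real_sublevel_pos {g : ℝ → ℝ} {a b : ℝ} (hab : a < b) :
    ∃ c : ℕ, 0 < volume.real (Icc a b ∩ {x | g x ≤ c}) := by
  by_contra! hcon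
  have h0 : ∀ c : ℕ, volume (Icc a b ∩ {x | g x ≤ c}) = 0 := fun c =>
    (measureReal_eq_zero_iff ((measure_mono inter_subset_left).trans_lt (by simp)).ne).1
      (le_antisymm (hcon c) measureReal_nonneg)
  have h1 := measure_iUnion_null h0
  have h2 : Icc a b ⊆ ⋃ c : ℕ, Icc a b ∩ {x | g x ≤ c} := fun x hx =>
    mem_iUnion.2 ((exists_nat_ge (g x)).imp fun c hc => ⟨hx, hc⟩)
  have h3 := measure_mono_null h2 h1
  rw [Real.volume_Icc, ENNReal.ofReal_eq_zero] at h3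
  linarith

end Lavrentiev

end

open Lavrentiev in
theorem theorem1 (n : ℕ) (p t T : ℝ) (hp : 1 ≤ p) (htT : t < T)
    (Λ : ℝ → Lavrentiev.E n → Lavrentiev.E n → ℝ≥0∞) (Ψ : ℝ → Lavrentiev.E n → ℝ≥0∞)
    (hbasic : Lavrentiev.BasicAssumptions t T Λ Ψ)
    (hS : Lavrentiev.ConditionS p t T Λ)
    (y : ℝ → Lavrentiev.E n) (hy : Lavrentiev.IsW1p p t T y)
    (hF : Lavrentiev.energy t T Λ Ψ y < ∞)
    (O : Set (Lavrentiev.E n)) (hO : O ∈ 𝓝ˢ (y '' Icc t T))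
    (hBΨ : ∃ M : ℝ≥0, ∀ s ∈ Icc t T, ∀ z ∈ O, Ψ s z ≤ M)
    (hCΨ : ∀ z ∈ y '' Icc t T, ContinuousOn (fun s => Ψ s z) (Icc t T))
    (hBΛ : ∃ ν₀ : ℝ, 0 < ν₀ ∧ ∃ M : ℝ≥0,
      ∀ s ∈ Icc t T, ∀ z ∈ O, ∀ v : Lavrentiev.E n, ‖v‖ ≤ ν₀ → Λ s z v ≤ M)
    (hΛ : ∫⁻ s in Icc t T, Λ s (y s) (deriv y s) < ∞) :
    Lavrentiev.NoLavrentievGap p t T Λ Ψ (Lavrentiev.admissibleInit p t T (y t)) y ∧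
    ((∃ V : Set (Lavrentiev.E n), IsOpen V ∧ (V ∩ y '' Icc t T).Nonempty ∧
        ∀ r : ℝ, 0 < r → ∃ M : ℝ≥0, ∀ s ∈ Icc t T, ∀ z ∈ V ∩ y '' Icc t T,
          ∀ v : Lavrentiev.E n, ‖v‖ ≤ r → Λ s z v ≤ M) →
      Lavrentiev.NoLavrentievGap p t T Λ Ψ
        (Lavrentiev.admissibleBoth p t T (y t) (y T)) y) := by
  have hyO : ∀ x ∈ Icc t T, y x ∈ O := fun x hx =>
    subset_of_mem_nhdsSet hO (mem_image_of_mem y hx)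
  obtain ⟨MΨ, hMΨ⟩ := hBΨ
  obtain ⟨ν, hν, M₁, hM₁⟩ := hBΛ
  have hMΨ' : ∀ s ∈ Icc t T, ∀ x ∈ Icc t T, Ψ s (y x) ≤ MΨ := fun s hs x hx =>
    hMΨ s hs _ (hyO x hx)
  have hCΨ' : ∀ x ∈ Icc t T, ContinuousOn (fun s => Ψ s (y x)) (Icc t T) := fun x hx =>
    hCΨ _ (mem_image_of_mem y hx)
  have hM₁' : ∀ s ∈ Icc t T, ∀ x ∈ Icc t T, ∀ v : E n, ‖v‖ ≤ ν → Λ s (y x) v ≤ M₁ :=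
    fun s hs x hx => hM₁ s hs _ (hyO x hx)
  have hgm : Measurable (fun x => ‖deriv y x‖) := (measurable_deriv y).norm
  have hgint : IntegrableOn (fun x => ‖deriv y x‖) (Icc t T) :=
    (hy.memLp_deriv.integrable (by simpa using hp)).norm
  have hyc : ContinuousOn y (Icc t T) := by
    have := hy.absCont.continuousOn
    rwa [uIcc_of_le htT.le] at this
  refine ⟨?_, ?_⟩
  · refine noLavrentievGap_of_stretch (r := ν) (c := 0) (S := fun _ => ∅) (M₂ := 0) hp htT.le hν
      le_rfl hbasic hS hy hMΨ' hCΨ' hΛ hM₁' (by simp) (by simp) (by simp) hν.le (by simp) ?_ ?_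
    · intro h
      simpa using excess_nonneg hν (le_add_of_nonneg_right h.cast_nonneg) hgm
    · intro h ψ hψ _ hW
      exact ⟨hW, by simp [hψ]⟩
  · rintro ⟨V, hV, hVne, hVM⟩
    obtain ⟨a, b, hab, hsub, habV⟩ := exists_Icc_mapsTo htT hyc hV hVne
    obtain ⟨c, hc⟩ := exists_nat_volume_real_sublevel_pos (g := fun x => ‖deriv y x‖) hab
    set B := Icc a b ∩ {x | ‖deriv y x‖ ≤ c} with hB
    have hBm : MeasurableSet B := measurableSet_Icc.inter (measurableSet_le hgm measurable_const)
    have hBI : B ⊆ Icc t T := inter_subset_left.trans hsub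
    -- Doubled speeds on `B` are at most `2c`; the extra `1` keeps the radius positive when `c = 0`.
    obtain ⟨M₂, hM₂⟩ := hVM (2 * c + 1) (by positivity)
    have hex : Tendsto (fun h : ℕ => 2 * excess t T ν (fun x => ‖deriv y x‖) (ν + c + h))
        atTop (𝓝 0) := by
      simpa [excess] using (tendsto_setIntegral_superlevel measurableSet_Icc hgm
        (fun x => ‖deriv y x‖ / ν - 1)
        ((hgint.div_const ν).sub (integrableOn_const (by simp))) (ν + c)).const_mul 2
    obtain ⟨N, hN⟩ := eventually_atTop.1 (hex.eventually_le_const hc)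
    have hS' : ∀ h : ℕ, ∃ S ⊆ B, MeasurableSet S ∧
        volume.real S = 2 * excess t T ν (fun x => ‖deriv y x‖) (ν + c + N + h) := by
      intro h
      refine exists_subset_volume_real_eq htT.le hBm hBI ?_ ?_
      · have := excess_nonneg (t := t) (T := T) (r := ν + c + N + h) hν
          (by rw [add_assoc, add_assoc]; exact le_add_of_nonneg_right (by positivity)) hgm
        positivity
      · have := hN (N + h) (Nat.le_add_right _ _)
        rwa [Nat.cast_add, ← add_assoc] at this
    choose S hSB hSm hSv using hS'
    -- In the threshold, `ν` makes `w ≥ 1` on the fast set, `c` keeps that set disjoint from `S`,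
    -- and `N` makes twice the excess at most `|B|`, so that `S` fits in `B`.
    refine noLavrentievGap_of_stretch (r := ν + c + N) (c := c) (S := S) (M₂ := M₂) hp htT.le hν
      ?_ hbasic hS hy hMΨ' hCΨ' hΛ hM₁' hSm (fun h => (hSB h).trans hBI)
      (fun h x hx => (hSB h hx).2) ?_ ?_ ?_ ?_
    · rw [add_assoc]
      exact le_add_of_nonneg_right (by positivity)
    · have : (0 : ℝ) ≤ N := N.cast_nonneg
      linarith
    · intro h x hx s hs v hv
      exact hM₂ s hs _ ⟨habV x (hSB h hx).1, mem_image_of_mem y (hBI (hSB h hx))⟩ v (by linarith)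
    · intro h
      rw [hSv]
      linarith
    · intro h ψ hψ hψT hW
      refine ⟨hW, by simp [hψ], ?_⟩
      rw [Function.comp_apply, hψT (by rw [hSv]; ring)]
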